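/- Let $K$ be a simplicial complex on a finite vertex set $V$, i.e. a collection of subsets of $V$ closed under inclusion (so $\varnothing$ is a face of dimension $-1$ once $K$ is non-empty), let $d\ge 0$, and let $F_1,\dots,F_n$ be the $d$-faces of $K$ (the faces with $d+1$ elements). Let $B^{up}$ be the $0/1$ matrix with rows indexed by the $(d+1)$-faces and columns indexed by the $d$-faces, with entry $1$ exactly when the $d$-face is contained in the $(d+1)$-face; let $B^{down}$ be the $0/1$ matrix with rows indexed by the $(d-1)$-faces and columns indexed by the $d$-faces, with entry $1$ exactly when the $(d-1)$-face is contained in the $d$-face. Let $d_i^{up}$ be the number of $(d+1)$-faces containing $F_i$ and $d_i^{down}=d+1$ the number of $(d-1)$-faces contained in $F_i$. Below, $B$ and $d_i$ denote $B^{up},d_i^{up}$ ("up case") or $B^{down},d_i^{down}$ ("down case"). In the up case assume that every $d$-face is contained in at least one $(d+1)$-face, so that in both cases $\|x\|=\sum_i d_i|x_i|$ is a norm on $\mathbb R^n$. For $t\in\mathbb R$ let $\mathrm{Sgn}(t)=\{1\}$ if $t>0$, $\{-1\}$ if $t<0$, and $[-1,1]$ if $t=0$, extended to vectors coordinatewise.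 The signless 1-Laplacian is the set-valued map $\Delta_1x=B^{T}\,\mathrm{Sgn}(Bx)$. A vector $x\in\mathbb R^n\setminus\{0\}$ is an eigenvector with eigenvalue $\mu\in\mathbb R$ if $\mu D\,\mathrm{Sgn}(x)\cap\Delta_1x\neq\varnothing$, where $D=\mathrm{diag}(d_1,\dots,d_n)$. Let $I(x)=\sum_j|(Bx)_j|$ and $X=\{x\in\mathbb R^n:\|x\|=1\}$. For $T\subset X$ with $T=-T$, let $\gamma(T)$ be the Krasnoselskii genus: $\gamma(\varnothing)=0$, and otherwise $\gamma(T)$ is the least $m$ for which there is an odd continuous map $T\to\mathbb S^{m-1}$. For $1\le k\le n$ let $$c_k=\inf_{T=-T\subset X,\ \gamma(T)\ge k}\ \sup_{x\in T} I(x),$$ so that $c_1\le\dots\le c_n$, and let the multiplicity of $c_k$ be the number of indices $j\in\{1,\dots,n\}$ with $c_j=c_k$. Two distinct $d$-faces are up-neighbours if both are contained in a common $(d+1)$-face of $K$, and down-neighbours if they contain a common $(d-1)$-face. The up- (resp. down-) nodal domains of $x$ are the connected components, for the up- (resp. down-) neighbour relation, of the support $\{F_i: x_i\ne0\}$, where connecting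 paths stay in the support. **Theorem (Courant nodal domain theorem).** In the up case and in the down case: let $1\le k\le n$, let $x$ be an eigenvector with eigenvalue $c_k$, let $r$ be the multiplicity of $c_k$, and let $S(x)$ be the number of up- (resp. down-) nodal domains of $x$. Then $$1\le S(x)\le k+r-1 .$$ -/

import Mathlib

/-! Signless 1-Laplacians of finite simplicial complexes, their variational eigenvalues, and
nodal domains. -/

noncomputable section

namespace SignlessLaplacian

open scoped Matrix

section Complexes

variable {V : Type*}

/-- An abstract simplicial complex on `V`: a collection of finite subsets of `V` closed under
inclusion. In particular the empty set, the unique face of dimension `-1`, belongs to it as soon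
as it has a face at all. -/
abbrev SComplex (V : Type*) := LowerSet (Finset V)

/-- The faces of `K` of cardinality `m`, that is, of dimension `m - 1`. -/
abbrev FaceOfCard (K : SComplex V) (m : ℕ) := {F : Finset V // F ∈ K ∧ F.card = m}

/-- The `n`-dimensional faces of `K`, those of cardinality `n + 1`. -/
abbrev Face (K : SComplex V) (n : ℕ) := FaceOfCard K (n + 1)

instance [Finite V] (K : SComplex V) (m : ℕ) : Fintype (FaceOfCard K m) := Fintype.ofFinite _

open Classical in
/-- The incidence matrix whose rows are the `(n+1)`-faces and whose columns are the `n`-faces: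
the entry is `1` if the `n`-face is in the boundary of the `(n+1)`-face. -/
def upIncidence (K : SComplex V) (n : ℕ) : Matrix (Face K (n + 1)) (Face K n) ℝ :=
  fun G F => if F.1 ⊆ G.1 then 1 else 0

open Classical in
/-- The incidence matrix whose rows are the `(n-1)`-faces (the faces of cardinality `n`) and whose
columns are the `n`-faces: the entry is `1` if the `(n-1)`-face is in the boundary of the
`n`-face. -/
def downIncidence (K : SComplex V) (n : ℕ) : Matrix (FaceOfCard K n) (Face K n) ℝ :=
  fun E F => if E.1 ⊆ F.1 then 1 else 0

/-- The up-degree of an `n`-face: the number of `(n+1)`-faces that contain it. -/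
def upDegree (K : SComplex V) (n : ℕ) (F : Face K n) : ℕ :=
  Nat.card {G : Face K (n + 1) // F.1 ⊆ G.1}

/-- The down-degree of an `n`-face: the number of `(n-1)`-faces in its boundary. -/
def downDegree (K : SComplex V) (n : ℕ) (F : Face K n) : ℕ :=
  Nat.card {E : FaceOfCard K n // E.1 ⊆ F.1}

theorem downDegree_eq (K : SComplex V) (n : ℕ) (F : Face K n) : downDegree K n F = n + 1 := by
  have e : {E : FaceOfCard K n // E.1 ⊆ F.1} ≃ {E : Finset V // E ∈ F.1.powersetCard n} :=
    { toFun := fun E => ⟨E.1.1, Finset.mem_powersetCard.2 ⟨E.2, E.1.2.2⟩⟩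
      invFun := fun E => ⟨⟨E.1, K.lower (Finset.mem_powersetCard.1 E.2).1 F.2.1,
        (Finset.mem_powersetCard.1 E.2).2⟩, (Finset.mem_powersetCard.1 E.2).1⟩
      left_inv := fun _ => rfl
      right_inv := fun _ => rfl }
  rw [downDegree, Nat.card_congr e, Nat.card_eq_fintype_card, Fintype.card_coe,
    Finset.card_powersetCard, F.2.2]
  simp

/-- Two distinct `n`-faces are up-neighbours if both are in the boundary of one `(n+1)`-face. -/
def upGraph (K : SComplex V) (n : ℕ) : SimpleGraph (Face K n) where
  Adj F F' := F ≠ F' ∧ ∃ G : Face K (n + 1), F.1 ⊆ G.1 ∧ F'.1 ⊆ G.1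
  symm := ⟨fun _ _ h => ⟨h.1.symm, h.2.imp fun _ hG => hG.symm⟩⟩
  loopless := ⟨fun _ h => h.1 rfl⟩

/-- Two distinct `n`-faces are down-neighbours if they share an `(n-1)`-face. -/
def downGraph (K : SComplex V) (n : ℕ) : SimpleGraph (Face K n) where
  Adj F F' := F ≠ F' ∧ ∃ E : FaceOfCard K n, E.1 ⊆ F.1 ∧ E.1 ⊆ F'.1
  symm := ⟨fun _ _ h => ⟨h.1.symm, h.2.imp fun _ hE => hE.symm⟩⟩
  loopless := ⟨fun _ h => h.1 rfl⟩

end Complexes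

/-- The number of nodal domains of `x` for the neighbour relation `G`: the connected components of
the support of `x`, where paths have to stay in the support. -/
def nodalCount {κ : Type*} (G : SimpleGraph κ) (x : κ → ℝ) : ℕ :=
  Nat.card (G.induce {j | x j ≠ 0}).ConnectedComponent

/-- The set-valued sign. -/
def Sgn (t : ℝ) : Set ℝ :=
  if 0 < t then {1} else if t < 0 then {-1} else Set.Icc (-1) 1

/-- The set-valued sign of a vector, coordinate by coordinate. -/
def SgnVec {ι : Type*} (y : ι → ℝ) : Set (ι → ℝ) := {z | ∀ i, z i ∈ Sgn (y i)}

section Spectrum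

variable {ι κ : Type*} [Fintype ι] [Fintype κ]

/-- The 1-Laplacian `Bᵀ Sgn (B x)` of an incidence matrix `B`, a set-valued map. -/
def oneLaplacian (B : Matrix ι κ ℝ) (x : κ → ℝ) : Set (κ → ℝ) :=
  (fun z => Bᵀ *ᵥ z) '' SgnVec (B *ᵥ x)

/-- `(μ, x)` is a (normalized) eigenpair: `x ≠ 0`, and `μ D Sgn x` meets the 1-Laplacian of `x`,
where `D` is the diagonal matrix of the degrees `d`. -/
def IsEigenpair (B : Matrix ι κ ℝ) (d : κ → ℕ) (μ : ℝ) (x : κ → ℝ) : Prop :=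
  x ≠ 0 ∧ ((fun w j => μ * ((d j : ℝ) * w j)) '' SgnVec x ∩ oneLaplacian B x).Nonempty

/-- The function `I(x) = ∑ᵢ |(B x)ᵢ|`. -/
def energy (B : Matrix ι κ ℝ) (x : κ → ℝ) : ℝ := ∑ i, |(B *ᵥ x) i|

/-- The weighted norm `‖x‖ = ∑ⱼ dⱼ |xⱼ|`. -/
def weightedNorm (d : κ → ℕ) (x : κ → ℝ) : ℝ := ∑ j, (d j : ℝ) * |x j|

/-- The Krasnoselskii genus of a symmetric set `T`: the least `m` such that there is an odd
continuous map from `T` to the unit sphere of `ℝᵐ` (and `⊤` if there is none). For `m = 0` the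
sphere is empty, so the genus is `0` exactly for `T = ∅`. -/
def genus {E : Type*} [TopologicalSpace E] [Neg E] (T : Set E) : ℕ∞ :=
  ⨅ (m : ℕ) (_ : ∃ h : E → EuclideanSpace ℝ (Fin m), ContinuousOn h T ∧
    Set.MapsTo h T (Metric.sphere 0 1) ∧ ∀ x ∈ T, h (-x) = -h x), (m : ℕ∞)

/-- The `k`-th variational eigenvalue: the infimum of the suprema of `I` over the symmetric subsets
`T` of the unit sphere `‖x‖ = 1` that have genus at least `k`. -/
def variationalEigenvalue (B : Matrix ι κ ℝ) (d : κ → ℕ) (k : ℕ) : ℝ :=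
  sInf {a | ∃ T : Set (κ → ℝ), (∀ x ∈ T, weightedNorm d x = 1) ∧ (∀ x ∈ T, -x ∈ T) ∧
    (k : ℕ∞) ≤ genus T ∧ IsLUB (energy B '' T) a}

/-- The multiplicity of the `k`-th variational eigenvalue: the number of indices `j` between `1`
and the dimension whose variational eigenvalue equals the `k`-th one. -/
def eigenvalueMultiplicity (B : Matrix ι κ ℝ) (d : κ → ℕ) (k : ℕ) : ℕ :=
  Set.ncard {j : ℕ | 1 ≤ j ∧ j ≤ Fintype.card κ ∧
    variationalEigenvalue B d j = variationalEigenvalue B d k}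

end Spectrum

end SignlessLaplacian

end

open SignlessLaplacian

/-! Let `x` be an eigenvector with eigenvalue `μ = c_k` and `S` nodal domains. The support of each
row of `B` is a clique of the neighbour graph, so it meets at most one nodal domain. Choose `z ∈ Sgn
(Bx)` and `w ∈ Sgn x` with `Bᵀ z = μ D w`. If `x` is rescaled by an arbitrary factor on each nodal
domain, every row of `Bx` is multiplied by a single factor, and pairing with `z` and `w` gives `I(y)
= μ ‖y‖` for every rescaled vector `y` (`energy_nodalScale`). These vectors form an `S`-dimensional
space whose unit sphere has genus at least `S` (`nodalCount_le_genus`), and `I` is constantly `μ` on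
it. Hence `c_j ≤ c_k` for all `j ≤ S`; by monotonicity `c_j = c_k` for `k ≤ j ≤ S`, which forces `S
- k + 1 ≤ r`.

The genus bound rests on `borsuk_ulam`, proved with chains modulo two. The hemispheres of the
cross-polytope satisfy `∂h_{k+1} = h_k + (-1)_* h_k`, and iterated barycentric subdivision keeps
this relation. If an odd `f` into `ℝᵐ` had no zero, the signs of its coordinates would be 0-cochains
`s i` with `s i (-v) = s i v + 1`. The product of their coboundaries is 1 on the subdivided top
hemisphere (`evalCochain_coboundaryProduct_eq_one`). Yet on every sufficiently small simplex some
coordinate of `f` keeps its sign, so the product vanishes (`coboundaryProduct_eq_zero`). -/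

noncomputable section

namespace SignlessLaplacian

open scoped Matrix

/-! ### Ordered simplicial chains modulo two. -/

section Chains

variable {E : Type*}

/-- Finite formal sums, with coefficients modulo two, of simplices given by their lists of
vertices. -/
abbrev Chain (E : Type*) := List E →₀ ZMod 2

/-- The cone with apex `v` over a chain. -/
def cone (v : E) : Chain E →ₗ[ZMod 2] Chain E := Finsupp.lmapDomain _ _ (List.cons v)

/-- The boundary of a simplex; that of a single vertex is the empty simplex. -/
def simplexBoundary : List E → Chain E
  | [] => 0
  | v :: l => Finsupp.single l 1 + cone v (simplexBoundary l)

/-- The augmented boundary operator. -/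
def boundary : Chain E →ₗ[ZMod 2] Chain E := Finsupp.linearCombination _ simplexBoundary

/-- The linear map of chains induced by a map of vertices. -/
def pushforward (g : E → E) : Chain E →ₗ[ZMod 2] Chain E := Finsupp.lmapDomain _ _ (List.map g)

@[simp] lemma cone_single (v : E) (l : List E) :
    cone v (Finsupp.single l 1) = Finsupp.single (v :: l) 1 := by
  simp [cone]

@[simp] lemma pushforward_single (g : E → E) (l : List E) :
    pushforward g (Finsupp.single l 1) = Finsupp.single (l.map g) 1 := by
  simp [pushforward]

@[simp] lemma boundary_single (l : List E) :
    boundary (Finsupp.single l 1) = simplexBoundary l := by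
  simp [boundary]

/-- Two linear maps of chains that agree on simplices are equal. -/
lemma chain_hom_ext {M : Type*} [AddCommMonoid M] [Module (ZMod 2) M]
    {f g : Chain E →ₗ[ZMod 2] M}
    (h : ∀ l, f (Finsupp.single l 1) = g (Finsupp.single l 1)) (c : Chain E) : f c = g c := by
  have : f = g := Finsupp.lhom_ext' fun l => LinearMap.ext_ring (h l)
  rw [this]

lemma chain_add_self {M : Type*} [AddCommGroup M] [Module (ZMod 2) M] (c : M) : c + c = 0 := by
  rw [← two_smul (ZMod 2) c, show (2 : ZMod 2) = 0 from rfl, zero_smul]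

lemma boundary_cone (v : E) (c : Chain E) : boundary (cone v c) = c + cone v (boundary c) :=
  chain_hom_ext (f := boundary ∘ₗ cone v) (g := LinearMap.id + cone v ∘ₗ boundary)
    (fun l => by simp [simplexBoundary]) c

lemma boundary_simplexBoundary (l : List E) : boundary (simplexBoundary l) = 0 := by
  induction l with
  | nil => simp [simplexBoundary]
  | cons v l ih => simp [simplexBoundary, boundary_cone, ih, chain_add_self]

lemma pushforward_cone (g : E → E) (v : E) (c : Chain E) :
    pushforward g (cone v c) = cone (g v) (pushforward g c) :=
  chain_hom_ext (f := pushforward g ∘ₗ cone v) (g := cone (g v) ∘ₗ pushforward g)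
    (fun l => by simp) c

lemma pushforward_simplexBoundary (g : E → E) (l : List E) :
    pushforward g (simplexBoundary l) = simplexBoundary (l.map g) := by
  induction l with
  | nil => simp [simplexBoundary]
  | cons v l ih => simp [simplexBoundary, pushforward_cone, ih]

lemma pushforward_boundary (g : E → E) (c : Chain E) :
    pushforward g (boundary c) = boundary (pushforward g c) :=
  chain_hom_ext (f := pushforward g ∘ₗ boundary) (g := boundary ∘ₗ pushforward g)
    (fun l => by simp [pushforward_simplexBoundary]) c

/-- The chains all of whose simplices satisfy `p`. -/
abbrev chainsOf (p : List E → Prop) : Submodule (ZMod 2) (Chain E) :=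
  Finsupp.supported (ZMod 2) (ZMod 2) {l | p l}

lemma single_mem_chainsOf {p : List E → Prop} {l : List E} (h : p l) :
    Finsupp.single l 1 ∈ chainsOf p :=
  Finsupp.single_mem_supported _ _ h

/-- A linear map sends the chains of type `p` to a submodule as soon as it does so with the
simplices of type `p`. -/
lemma map_mem_of_chainsOf {M : Type*} [AddCommMonoid M] [Module (ZMod 2) M]
    {p : List E → Prop} (f : Chain E →ₗ[ZMod 2] M) (N : Submodule (ZMod 2) M)
    (h : ∀ l, p l → f (Finsupp.single l 1) ∈ N) {c : Chain E} (hc : c ∈ chainsOf p) :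
    f c ∈ N := by
  rw [chainsOf, Finsupp.supported_eq_span_single] at hc
  refine (Submodule.span_le (p := N.comap f)).2 ?_ hc
  rintro _ ⟨l, hl, rfl⟩
  exact h l hl

lemma chainsOf_mono {p q : List E → Prop} (h : ∀ l, p l → q l) : chainsOf p ≤ chainsOf q :=
  Finsupp.supported_mono h

lemma simplexBoundary_mem (l : List E) :
    simplexBoundary l ∈ chainsOf fun m => m ⊆ l ∧ m.length + 1 = l.length := by
  induction l with
  | nil => exact Submodule.zero_mem _
  | cons v l ih =>
    refine Submodule.add_mem _ (single_mem_chainsOf ⟨List.subset_cons_self v l, rfl⟩) ?_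
    refine map_mem_of_chainsOf _ _ (fun m hm => ?_) ih
    rw [cone_single]
    exact single_mem_chainsOf ⟨List.cons_subset_cons v hm.1, by simpa using hm.2⟩

end Chains

/-! ### Products of coboundaries and their antipodal behaviour. -/

section Cochains

variable {E : Type*} (s : ℕ → E → ZMod 2)

/-- The product of the coboundaries of the `0`-cochains `s (k - 1), …, s 0`. -/
def coboundaryProduct : ℕ → List E → ZMod 2
  | 0, [_] => 1
  | k + 1, v :: w :: l => (s k v + s k w) * coboundaryProduct k (w :: l)
  | _, _ => 0

/-- The product of the `0`-cochain `s k` with `coboundaryProduct s k`. -/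
def primitiveProduct (k : ℕ) : List E → ZMod 2
  | [] => 0
  | v :: l => s k v * coboundaryProduct s k (v :: l)

/-- The evaluation of a cochain on chains. -/
def evalCochain (φ : List E → ZMod 2) : Chain E →ₗ[ZMod 2] ZMod 2 :=
  Finsupp.linearCombination _ φ

@[simp] lemma evalCochain_single (φ : List E → ZMod 2) (l : List E) :
    evalCochain φ (Finsupp.single l 1) = φ l := by
  simp [evalCochain]

lemma evalCochain_primitiveProduct_cone (k : ℕ) (v : E) (c : Chain E) :
    evalCochain (primitiveProduct s k) (cone v c) =
      s k v * evalCochain (coboundaryProduct s k) (cone v c) :=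
  chain_hom_ext (f := evalCochain (primitiveProduct s k) ∘ₗ cone v)
    (g := s k v • (evalCochain (coboundaryProduct s k) ∘ₗ cone v))
    (fun l => by simp [primitiveProduct]) c

lemma coboundaryProduct_nil (k : ℕ) : coboundaryProduct s k [] = 0 := by
  cases k <;> rfl

lemma coboundaryProduct_zero_simplexBoundary (l : List E) :
    evalCochain (coboundaryProduct s 0) (simplexBoundary l) = 0 := by
  rcases l with _ | ⟨a, _ | ⟨b, _ | ⟨c, l⟩⟩⟩
  · simp [simplexBoundary]
  · simp [simplexBoundary, coboundaryProduct]
  · simp [simplexBoundary, coboundaryProduct, chain_add_self]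
  · refine (Submodule.mem_bot (ZMod 2)).1
      (map_mem_of_chainsOf _ ⊥ (fun m hm => ?_) (simplexBoundary_mem (a :: b :: c :: l)))
    rcases m with _ | ⟨d, _ | ⟨e, m⟩⟩ <;> simp_all [coboundaryProduct]

/-- Leibniz rule: when the product of the first `k` coboundaries is a cocycle, the coboundary of `s
k` times it is `δ(s k)` times it. The cocycle condition on `v :: w :: l` evaluates the cone term. -/
lemma primitiveProduct_simplexBoundary_of_cocycle {k : ℕ}
    (h : ∀ l, evalCochain (coboundaryProduct s k) (simplexBoundary l) = 0) (l : List E) :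
    evalCochain (primitiveProduct s k) (simplexBoundary l) = coboundaryProduct s (k + 1) l := by
  rcases l with _ | ⟨v, _ | ⟨w, l⟩⟩
  · simp [simplexBoundary, coboundaryProduct]
  · simp [simplexBoundary, coboundaryProduct, primitiveProduct]
  · have h' := h (v :: w :: l)
    rw [simplexBoundary, map_add, evalCochain_single] at h'
    have h2 : evalCochain (coboundaryProduct s k) (cone v (simplexBoundary (w :: l))) =
        coboundaryProduct s k (w :: l) := by
      have h3 := chain_add_self (coboundaryProduct s k (w :: l))
      exact add_left_cancel (h'.trans h3.symm)
    rw [simplexBoundary, map_add, evalCochain_single, evalCochain_primitiveProduct_cone, h2,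
      primitiveProduct, coboundaryProduct]
    ring

/-- By induction each further product is the coboundary of a `primitiveProduct`, so `∂∂ = 0` makes
it a cocycle. -/
lemma coboundaryProduct_simplexBoundary (k : ℕ) (l : List E) :
    evalCochain (coboundaryProduct s k) (simplexBoundary l) = 0 := by
  induction k generalizing l with
  | zero => exact coboundaryProduct_zero_simplexBoundary s l
  | succ k ih =>
    have h : evalCochain (coboundaryProduct s (k + 1)) (simplexBoundary l) =
        evalCochain (primitiveProduct s k) (boundary (simplexBoundary l)) :=
      chain_hom_ext (f := evalCochain (coboundaryProduct s (k + 1)))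
        (g := evalCochain (primitiveProduct s k) ∘ₗ boundary)
        (fun m => by simp [primitiveProduct_simplexBoundary_of_cocycle s ih]) _
    rw [h, boundary_simplexBoundary, map_zero]

lemma primitiveProduct_boundary (k : ℕ) (c : Chain E) :
    evalCochain (primitiveProduct s k) (boundary c) =
      evalCochain (coboundaryProduct s (k + 1)) c :=
  chain_hom_ext (f := evalCochain (primitiveProduct s k) ∘ₗ boundary)
    (g := evalCochain (coboundaryProduct s (k + 1)))
    (fun l => by
      simp [primitiveProduct_simplexBoundary_of_cocycle s (coboundaryProduct_simplexBoundary s k)])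
    c

/-- If `s i` is constant on a simplex for one `i < k`, the product vanishes on it. -/
lemma coboundaryProduct_eq_zero {k i : ℕ} (hi : i < k) {l : List E} {a : ZMod 2}
    (h : ∀ v ∈ l, s i v = a) : coboundaryProduct s k l = 0 := by
  induction k generalizing l with
  | zero => omega
  | succ k ih =>
    rcases l with _ | ⟨v, _ | ⟨w, l⟩⟩
    · rfl
    · rfl
    · rw [coboundaryProduct]
      rcases Nat.lt_succ_iff_lt_or_eq.1 hi with hi | rfl
      · rw [ih hi fun u hu => h u (List.mem_cons_of_mem _ hu), mul_zero]
      · rw [h v (by simp), h w (by simp), chain_add_self, zero_mul]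

section Antipodal

variable {s} {g : E → E} {p : E → Prop} {n : ℕ}
  (hs : ∀ i < n, ∀ v, p v → s i (g v) = s i v + 1)
include hs

/-- Only the sums `s i v + s i w` enter, and in them the two added ones cancel. -/
lemma coboundaryProduct_map {k : ℕ} (hk : k ≤ n) {l : List E} (hl : ∀ v ∈ l, p v) :
    coboundaryProduct s k (l.map g) = coboundaryProduct s k l := by
  induction k generalizing l with
  | zero => rcases l with _ | ⟨v, _ | ⟨w, l⟩⟩ <;> rfl
  | succ k ih =>
    rcases l with _ | ⟨v, _ | ⟨w, l⟩⟩
    · rfl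
    · rfl
    · have := ih (by omega) fun u hu => hl u (List.mem_cons_of_mem _ hu)
      rw [List.map_cons] at this
      rw [List.map_cons, List.map_cons, coboundaryProduct, this, coboundaryProduct,
        hs k hk v (hl v (by simp)), hs k hk w (hl w (by simp))]
      linear_combination (coboundaryProduct s k (w :: l)) * chain_add_self (1 : ZMod 2)

/-- The antipode adds 1 to the leading factor `s k v` and leaves the rest unchanged, so the two
values add up to the rest. -/
lemma primitiveProduct_add_pushforward {k : ℕ} (hk : k < n) {c : Chain E}
    (hc : c ∈ chainsOf fun l => ∀ v ∈ l, p v) :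
    evalCochain (primitiveProduct s k) (c + pushforward g c) =
      evalCochain (coboundaryProduct s k) c := by
  refine sub_eq_zero.1 ((Submodule.mem_bot (ZMod 2)).1 (map_mem_of_chainsOf
    (evalCochain (primitiveProduct s k) ∘ₗ (LinearMap.id + pushforward g) -
      evalCochain (coboundaryProduct s k)) ⊥ (fun l hl => ?_) hc))
  rcases l with _ | ⟨v, l⟩
  · simp [primitiveProduct, coboundaryProduct_nil]
  · have h1 := coboundaryProduct_map hs hk.le hl
    rw [List.map_cons] at h1
    have h2 := hs k hk v (hl v (by simp))
    simp only [LinearMap.sub_apply, LinearMap.comp_apply, LinearMap.add_apply, LinearMap.id_apply,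
      map_add, evalCochain_single, pushforward_single, List.map_cons, primitiveProduct, h1, h2,
      Submodule.mem_bot]
    linear_combination (coboundaryProduct s k (v :: l)) * chain_add_self (s k v)

/-- An antipodal system of chains, each having the sum of the previous one and its antipode as
boundary, is not killed by the product of the coboundaries of odd `0`-cochains. -/
lemma evalCochain_coboundaryProduct_eq_one {z : ℕ → Chain E} {v₀ : E}
    (h0 : z 0 = Finsupp.single [v₀] 1)
    (hz : ∀ k < n, boundary (z (k + 1)) = z k + pushforward g (z k))
    (hp : ∀ k < n, z k ∈ chainsOf fun l => ∀ v ∈ l, p v) {k : ℕ} (hk : k ≤ n) :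
    evalCochain (coboundaryProduct s k) (z k) = 1 := by
  induction k with
  | zero => simp [h0, coboundaryProduct]
  | succ k ih =>
    -- Stokes lowers the degree: the value on `z (k + 1)` is that of the primitive on `z k` plus its
    -- antipode, hence that of the shorter product on `z k`.
    rw [← primitiveProduct_boundary, hz k hk, primitiveProduct_add_pushforward hs hk (hp k hk),
      ih (by omega)]

end Antipodal

end Cochains

/-! ### Barycentric subdivision and the shrinking of diameters. -/

section Subdivision

lemma pushforward_neg_neg {E : Type*} [InvolutiveNeg E] (c : Chain E) :
    pushforward Neg.neg (pushforward Neg.neg c) = c :=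
  chain_hom_ext (f := pushforward Neg.neg ∘ₗ pushforward Neg.neg) (g := LinearMap.id)
    (fun l => by simp) c

variable {E : Type*} [NormedAddCommGroup E] [NormedSpace ℝ E]

/-- The barycentre of a list of points. -/
def barycentre (l : List E) : E := (l.length : ℝ)⁻¹ • l.sum

/-- Barycentric subdivision of the simplices with `k` vertices. -/
def subdivide : ℕ → Chain E →ₗ[ZMod 2] Chain E
  | 0 => LinearMap.id
  | k + 1 => Finsupp.linearCombination _ fun l =>
      cone (barycentre l) (subdivide k (simplexBoundary l))

lemma subdivide_succ_single (k : ℕ) (l : List E) :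
    subdivide (k + 1) (Finsupp.single l 1) =
      cone (barycentre l) (subdivide k (simplexBoundary l)) := by
  simp [subdivide]

lemma subdivide_zero (c : Chain E) : subdivide 0 c = c := rfl

attribute [irreducible] subdivide

lemma subdivide_vertex (v : E) :
    subdivide (0 + 1) (Finsupp.single [v] 1) = Finsupp.single [v] (1 : ZMod 2) := by
  simp only [subdivide_succ_single, subdivide_zero]
  simp [barycentre, simplexBoundary]

/-- The boundary of a cone is its base plus the cone over the boundary of the base; the latter
vanishes by `∂∂ = 0`. No condition on the lengths of the simplices is needed. -/
lemma boundary_subdivide (k : ℕ) (c : Chain E) :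
    boundary (subdivide (k + 1) c) = subdivide k (boundary c) := by
  induction k generalizing c with
  | zero =>
    refine chain_hom_ext (f := boundary ∘ₗ subdivide (0 + 1)) (g := subdivide 0 ∘ₗ boundary)
      (fun l => ?_) c
    simp only [LinearMap.comp_apply, subdivide_succ_single, boundary_cone, subdivide_zero,
      boundary_single, boundary_simplexBoundary, map_zero, add_zero]
  | succ k ih =>
    refine chain_hom_ext (f := boundary ∘ₗ subdivide (E := E) (k + 1 + 1))
      (g := subdivide (E := E) (k + 1) ∘ₗ boundary) (fun l => ?_) c
    simp only [LinearMap.comp_apply, subdivide_succ_single, boundary_cone, ih,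
      boundary_single, boundary_simplexBoundary, map_zero, add_zero]

lemma barycentre_map_neg (l : List E) : barycentre (l.map Neg.neg) = -barycentre l := by
  have h : (l.map Neg.neg).sum = -l.sum := by
    induction l with
    | nil => simp
    | cons v l ih => rw [List.map_cons, List.sum_cons, ih, List.sum_cons, neg_add]
  rw [barycentre, barycentre, h, List.length_map, smul_neg]

lemma pushforward_subdivide (k : ℕ) (c : Chain E) :
    pushforward Neg.neg (subdivide k c) = subdivide k (pushforward Neg.neg c) := by
  induction k generalizing c with
  | zero => simp only [subdivide_zero]
  | succ k ih =>
    refine chain_hom_ext (f := pushforward Neg.neg ∘ₗ subdivide (k + 1))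
      (g := subdivide (k + 1) ∘ₗ pushforward Neg.neg) (fun l => ?_) c
    simp only [LinearMap.comp_apply, subdivide_succ_single, pushforward_cone, ih,
      pushforward_simplexBoundary, pushforward_single, barycentre_map_neg]

lemma barycentre_mem {C : Set E} (hC : Convex ℝ C) {l : List E} (hl : l ≠ [])
    (h : ∀ v ∈ l, v ∈ C) : barycentre l ∈ C := by
  have h0 : (l.length : ℝ) ≠ 0 := by simpa using hl
  have := hC.sum_mem (t := Finset.univ) (w := fun _ : Fin l.length => (l.length : ℝ)⁻¹)
    (z := fun i => l[i]) (fun _ _ => by positivity) (by simp [h0])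
    (fun i _ => h _ (List.getElem_mem _))
  rw [← Finset.smul_sum] at this
  simpa [barycentre, Fin.sum_univ_getElem] using this

lemma norm_sum_sub_length_smul_le {D : ℝ} {x : E} {l : List E} (h : ∀ v ∈ l, dist v x ≤ D) :
    ‖l.sum - (l.length : ℝ) • x‖ ≤ l.length * D := by
  induction l with
  | nil => simp
  | cons v l ih =>
    have h1 := ih fun w hw => h w (List.mem_cons_of_mem _ hw)
    have h2 := h v (by simp)
    rw [dist_eq_norm] at h2
    have e : (v :: l).sum - ((v :: l).length : ℝ) • x =
        (v - x) + (l.sum - (l.length : ℝ) • x) := by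
      simp only [List.sum_cons, List.length_cons, Nat.cast_add, Nat.cast_one]
      module
    rw [e]
    refine (norm_add_le _ _).trans ?_
    push_cast [List.length_cons]
    linarith

/-- With `k + 1` vertices, `barycentre l - x` is `1 / (k + 1)` times the sum of `v - x` over the `k`
entries other than one occurrence of `x`. -/
lemma dist_barycentre_le {D : ℝ} (hD : 0 ≤ D) {N : ℕ} {l : List E} (hN : l.length ≤ N + 1)
    (h : ∀ v ∈ l, ∀ w ∈ l, dist v w ≤ D) {x : E} (hx : x ∈ l) :
    dist (barycentre l) x ≤ N / (N + 1) * D := by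
  classical
  obtain ⟨k, hk⟩ : ∃ k, l.length = k + 1 :=
    Nat.exists_eq_succ_of_ne_zero (List.length_pos_of_mem hx).ne'
  have hp := List.perm_cons_erase hx
  have hke : (l.erase x).length = k := by rw [List.length_erase_of_mem hx, hk]; rfl
  have h1 := norm_sum_sub_length_smul_le (x := x) (l := l.erase x) (D := D)
    fun v hv => h v (List.mem_of_mem_erase hv) x hx
  rw [hke] at h1
  have hk0 : (0 : ℝ) < k + 1 := by positivity
  have e : barycentre l - x = ((k : ℝ) + 1)⁻¹ • ((l.erase x).sum - (k : ℝ) • x) := by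
    rw [barycentre, hp.sum_eq, List.sum_cons, hk]
    push_cast
    have : ((k : ℝ) + 1)⁻¹ • (x + (l.erase x).sum) - ((k : ℝ) + 1)⁻¹ • ((k + 1 : ℝ) • x) =
        ((k : ℝ) + 1)⁻¹ • ((l.erase x).sum - (k : ℝ) • x) := by module
    rwa [inv_smul_smul₀ hk0.ne'] at this
  have hkN : (k : ℝ) ≤ N := by exact_mod_cast (by omega : k ≤ N)
  rw [dist_eq_norm, e, norm_smul, norm_inv, Real.norm_of_nonneg hk0.le]
  calc ((k : ℝ) + 1)⁻¹ * ‖(l.erase x).sum - (k : ℝ) • x‖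
      ≤ ((k : ℝ) + 1)⁻¹ * (k * D) := by gcongr
    _ = k / (k + 1) * D := by ring
    _ ≤ N / (N + 1) * D := by
        gcongr ?_ * D
        rw [div_le_div_iff₀ hk0 (by positivity)]
        nlinarith

/-- The simplices with `k` vertices and diameter at most `D` that lie in a member of `𝒞`. -/
def IsSmallSimplex (𝒞 : Set (Set E)) (k : ℕ) (D : ℝ) (l : List E) : Prop :=
  l.length = k ∧ (∃ C ∈ 𝒞, ∀ v ∈ l, v ∈ C) ∧ ∀ v ∈ l, ∀ w ∈ l, dist v w ≤ D

/-- The factor `N / (N + 1)` is the same for all `k ≤ N + 1`, so the bound inherited from the faces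
needs no adjustment. -/
lemma subdivide_single_mem {N k : ℕ} (hk : k ≤ N + 1) {D : ℝ} (hD : 0 ≤ D)
    {l : List E} (hl : l.length = k) (h : ∀ v ∈ l, ∀ w ∈ l, dist v w ≤ D) :
    subdivide k (Finsupp.single l 1) ∈ chainsOf fun m => m.length = k ∧
      (∀ v ∈ m, v ∈ convexHull ℝ {x | x ∈ l}) ∧
      ∀ v ∈ m, ∀ w ∈ m, dist v w ≤ N / (N + 1) * D := by
  induction k generalizing l with
  | zero =>
    obtain rfl := List.length_eq_zero_iff.1 hl
    rw [subdivide_zero]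
    exact single_mem_chainsOf (by simp)
  | succ k ih =>
    have hne : l ≠ [] := by rintro rfl; simp at hl
    rw [subdivide_succ_single]
    have h1 : subdivide k (simplexBoundary l) ∈ chainsOf fun m => m.length = k ∧
        (∀ v ∈ m, v ∈ convexHull ℝ {x | x ∈ l}) ∧
        ∀ v ∈ m, ∀ w ∈ m, dist v w ≤ N / (N + 1) * D := by
      refine map_mem_of_chainsOf _ _ (fun m hm => ?_) (simplexBoundary_mem l)
      refine chainsOf_mono (fun m' hm' => ⟨hm'.1, fun v hv => ?_, hm'.2.2⟩)
        (ih (by omega) (by omega) fun v hv w hw => h v (hm.1 hv) w (hm.1 hw))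
      exact convexHull_mono (fun x hx => hm.1 hx) (hm'.2.1 v hv)
    have hb : barycentre l ∈ convexHull ℝ {x | x ∈ l} :=
      barycentre_mem (convex_convexHull ℝ _) hne fun v hv => subset_convexHull ℝ _ hv
    -- Balls are convex, so the bound at the vertices extends to their hull, where the subdivided
    -- faces have their vertices.
    have hd : ∀ v ∈ convexHull ℝ {x | x ∈ l}, dist v (barycentre l) ≤ N / (N + 1) * D := by
      intro v hv
      refine Metric.mem_closedBall.1 (convexHull_min (fun x hx => ?_)
        (convex_closedBall (barycentre l) _) hv)
      rw [Metric.mem_closedBall, dist_comm]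
      exact dist_barycentre_le hD (by omega) h hx
    refine map_mem_of_chainsOf _ _ (fun m hm => ?_) h1
    rw [cone_single]
    refine single_mem_chainsOf ⟨by simp [hm.1], List.forall_mem_cons.2 ⟨hb, hm.2.1⟩, ?_⟩
    refine List.forall_mem_cons.2 ⟨List.forall_mem_cons.2 ⟨?_, fun w hw => ?_⟩,
      fun v hv => List.forall_mem_cons.2 ⟨hd v (hm.2.1 v hv), hm.2.2 v hv⟩⟩
    · rw [dist_self]; positivity
    · rw [dist_comm]; exact hd w (hm.2.1 w hw)

lemma iterate_subdivide_mem {𝒞 : Set (Set E)} (h𝒞 : ∀ C ∈ 𝒞, Convex ℝ C) {N k : ℕ}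
    (hk : k ≤ N + 1) {D : ℝ} (hD : 0 ≤ D) (r : ℕ) {c : Chain E}
    (hc : c ∈ chainsOf (IsSmallSimplex 𝒞 k D)) :
    (subdivide k)^[r] c ∈ chainsOf (IsSmallSimplex 𝒞 k ((N / (N + 1)) ^ r * D)) := by
  induction r with
  | zero => simpa using hc
  | succ r ih =>
    rw [Function.iterate_succ_apply']
    refine map_mem_of_chainsOf _ _ (fun l hl => ?_) ih
    obtain ⟨hlen, ⟨C, hC, hlC⟩, hd⟩ := hl
    refine chainsOf_mono (fun m hm => ⟨hm.1, ⟨C, hC, fun v hv => ?_⟩, ?_⟩)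
      (subdivide_single_mem hk (by positivity) hlen hd)
    · exact convexHull_min hlC (h𝒞 C hC) (hm.2.1 v hv)
    · rw [pow_succ', mul_assoc]; exact hm.2.2

end Subdivision

/-! ### Hemispheres of the cross-polytope. -/

section Hemispheres

/-- The hemispheres of the cross-polytope with vertices `±e i`. -/
def hemisphere {E : Type*} [Neg E] (e : ℕ → E) : ℕ → Chain E
  | 0 => Finsupp.single [e 0] 1
  | k + 1 => cone (e (k + 1)) (hemisphere e k + pushforward Neg.neg (hemisphere e k))

/-- A hemisphere is a cone over the sphere one dimension lower, which is a cycle because the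
antipode exchanges the two summands of its boundary relation. -/
lemma boundary_hemisphere {E : Type*} [InvolutiveNeg E] (e : ℕ → E) (k : ℕ) :
    boundary (hemisphere e (k + 1)) = hemisphere e k + pushforward Neg.neg (hemisphere e k) := by
  induction k with
  | zero =>
    have h : boundary (hemisphere e 0 + pushforward Neg.neg (hemisphere e 0)) = 0 := by
      simp only [hemisphere, pushforward_single, map_add, boundary_single, simplexBoundary,
        List.map_cons, List.map_nil, map_zero, add_zero]
      exact chain_add_self _
    rw [hemisphere.eq_def e (0 + 1), boundary_cone, h, map_zero, add_zero]
  | succ k ih =>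
    have h : boundary (hemisphere e (k + 1) + pushforward Neg.neg (hemisphere e (k + 1))) = 0 := by
      rw [map_add, ← pushforward_boundary, ih, map_add, pushforward_neg_neg,
        add_comm (pushforward _ (hemisphere e k)) (hemisphere e k)]
      exact chain_add_self _
    rw [hemisphere, boundary_cone, h, map_zero, add_zero]

/-- One sign per index means that no simplex has antipodal vertices, so each fits in a convex set
avoiding the origin. -/
lemma hemisphere_mem {E : Type*} [AddCommGroup E] [Module ℝ E] (e : ℕ → E) (k : ℕ) :
    hemisphere e k ∈ chainsOf fun l => l.length = k + 1 ∧
    ∃ ε : ℕ → ℝ, (∀ i, |ε i| = 1) ∧ ∀ v ∈ l, ∃ i ≤ k, v = ε i • e i := by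
  induction k with
  | zero => exact single_mem_chainsOf ⟨rfl, fun _ => 1, by simp, by simp⟩
  | succ k ih =>
    refine map_mem_of_chainsOf (p := fun l => l.length = k + 1 ∧
      ∃ ε : ℕ → ℝ, (∀ i, |ε i| = 1) ∧ ∀ v ∈ l, ∃ i ≤ k, v = ε i • e i) _ _ ?_
      (Submodule.add_mem _ ih (map_mem_of_chainsOf _ _ ?_ ih))
    · rintro l ⟨hl, ε, hε, h⟩
      rw [cone_single]
      refine single_mem_chainsOf ⟨by simp [hl], Function.update ε (k + 1) 1, fun i => ?_,
        List.forall_mem_cons.2 ⟨⟨k + 1, le_rfl, by simp⟩, fun v hv => ?_⟩⟩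
      · rcases eq_or_ne i (k + 1) with rfl | hi
        · simp
        · rw [Function.update_of_ne hi, hε]
      · obtain ⟨i, hi, rfl⟩ := h v hv
        exact ⟨i, by omega, by rw [Function.update_of_ne (by omega)]⟩
    · rintro l ⟨hl, ε, hε, h⟩
      rw [pushforward_single]
      refine single_mem_chainsOf ⟨by simp [hl], fun i => -ε i, by simpa using hε, fun v hv => ?_⟩
      obtain ⟨w, hw, rfl⟩ := List.mem_map.1 hv
      obtain ⟨i, hi, rfl⟩ := h w hw
      exact ⟨i, hi, by rw [neg_smul]⟩

end Hemispheres

/-! ### The Borsuk–Ulam theorem. -/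

section BorsukUlam

/-- The orthant part `{v | ‖v‖ ≤ 1, ∑ εᵢ vᵢ ≥ 1}`. -/
def orthantSlab (m : ℕ) (ε : ℕ → ℝ) : Set (Fin (m + 1) → ℝ) :=
  {v | ‖v‖ ≤ 1 ∧ 1 ≤ ∑ j : Fin (m + 1), ε j * v j}

lemma convex_orthantSlab (m : ℕ) (ε : ℕ → ℝ) : Convex ℝ (orthantSlab m ε) := by
  have h : orthantSlab m ε = Metric.closedBall (0 : Fin (m + 1) → ℝ) 1 ∩ {v | 1 ≤ ∑ j : Fin (m + 1), ε j * v j} := by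
    ext v; simp [orthantSlab]
  rw [h]
  refine (convex_closedBall _ _).inter (convex_halfSpace_ge ⟨fun v w => ?_, fun c v => ?_⟩ 1)
  · simp only [Pi.add_apply, mul_add, Finset.sum_add_distrib]
  · simp only [Pi.smul_apply, smul_eq_mul, Finset.mul_sum]
    exact Finset.sum_congr rfl fun j _ => by ring

/-- The vertices of the cross-polytope. -/
def crossVertex (m i : ℕ) : Fin (m + 1) → ℝ := Pi.single (Fin.ofNat (m + 1) i) 1

lemma smul_crossVertex_mem {m i : ℕ} (hi : i ≤ m) {ε : ℕ → ℝ} (hε : ∀ i, |ε i| = 1) :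
    ε i • crossVertex m i ∈ orthantSlab m ε := by
  have hv : (Fin.ofNat (m + 1) i : ℕ) = i := Nat.mod_eq_of_lt (by omega)
  constructor
  · rw [norm_smul, Real.norm_eq_abs, hε, crossVertex, Pi.norm_single]
    simp
  · rw [Finset.sum_eq_single (Fin.ofNat (m + 1) i)]
    · have := sq_abs (ε i)
      rw [hε] at this
      rw [hv, Pi.smul_apply, crossVertex, Pi.single_eq_same]
      simp only [smul_eq_mul]
      nlinarith
    · intro j _ hj
      rw [Pi.smul_apply, crossVertex, Pi.single_eq_of_ne hj, smul_zero, mul_zero]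
    · simp

/-- The compact region containing the slabs. -/
def crossRegion (m : ℕ) : Set (Fin (m + 1) → ℝ) := {v | ‖v‖ ≤ 1 ∧ 1 ≤ ∑ j, |v j|}

lemma isCompact_crossRegion (m : ℕ) : IsCompact (crossRegion m) := by
  have h : crossRegion m = Metric.closedBall 0 1 ∩ {v | 1 ≤ ∑ j, |v j|} := by
    ext v; simp [crossRegion]
  rw [h]
  exact (isCompact_closedBall _ _).inter_right (isClosed_le (by fun_prop) (by fun_prop))

lemma ne_zero_of_mem_crossRegion {m : ℕ} {v : Fin (m + 1) → ℝ} (hv : v ∈ crossRegion m) :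
    v ≠ 0 := by
  rintro rfl
  have := hv.2
  norm_num at this

lemma orthantSlab_subset {m : ℕ} {ε : ℕ → ℝ} (hε : ∀ i, |ε i| = 1) :
    orthantSlab m ε ⊆ crossRegion m := by
  refine fun v hv => ⟨hv.1, hv.2.trans (Finset.sum_le_sum fun j _ => ?_)⟩
  calc ε j * v j ≤ |ε j * v j| := le_abs_self _
    _ = |v j| := by rw [abs_mul, hε, one_mul]

open Classical in
/-- A two-valued sign of `a`, decided by comparing `v` with `-v` where `a = 0`. -/
def oddSign {E : Type*} [Neg E] (a : ℝ) (v : E) : ZMod 2 :=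
  if 0 < a ∨ a = 0 ∧ WellOrderingRel v (-v) then 1 else 0

/-- When `a = 0`, exactly one of `v` and `-v` precedes the other, since they differ. -/
lemma oddSign_neg {m : ℕ} (a : ℝ) {v : Fin m → ℝ} (hv : v ≠ 0) :
    oddSign (-a) (-v) = oddSign a v + 1 := by
  have hv' : v ≠ -v := fun h => hv (self_eq_neg.1 h)
  have h01 : (1 : ZMod 2) + 1 = 0 := rfl
  rcases lt_trichotomy a 0 with ha | rfl | ha
  · simp [oddSign, ha, ha.not_gt, ha.ne]
  · rcases trichotomous_of WellOrderingRel v (-v) with h | h | h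
    · have := asymm_of WellOrderingRel h
      simp [oddSign, h, this, h01]
    · exact absurd h hv'
    · have := asymm_of WellOrderingRel h
      simp [oddSign, h, this]
  · simp [oddSign, ha, ha.not_gt, ha.ne', h01]

/-- **Borsuk–Ulam theorem**: an odd continuous map from `ℝᵐ⁺¹ ∖ {0}` to `ℝᵐ` has a zero. -/
theorem borsuk_ulam {m : ℕ} {f : (Fin (m + 1) → ℝ) → Fin m → ℝ} (hf : ContinuousOn f {0}ᶜ)
    (hodd : ∀ v ≠ 0, f (-v) = -f v) : ∃ v ≠ 0, f v = 0 := by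
  by_contra! hne
  have hK := isCompact_crossRegion m
  have hfK : ContinuousOn f (crossRegion m) :=
    hf.mono fun v hv => ne_zero_of_mem_crossRegion hv
  have he : crossVertex m 0 ∈ crossRegion m := by
    have := smul_crossVertex_mem (m := m) (Nat.zero_le m) (ε := fun _ => 1) (by simp)
    rw [one_smul] at this
    exact orthantSlab_subset (by simp) this
  obtain ⟨v₀, hv₀, hmin⟩ := hK.exists_isMinOn ⟨_, he⟩ hfK.norm
  set a := ‖f v₀‖ with ha
  have ha0 : 0 < a := norm_pos_iff.2 (hne v₀ (ne_zero_of_mem_crossRegion hv₀))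
  -- Within distance `δ` no coordinate of `f` changes by as much as `a`, the minimum of `‖f‖`.
  obtain ⟨δ, hδ, hunif⟩ := Metric.uniformContinuousOn_iff.1
    (hK.uniformContinuousOn_of_continuous hfK) a ha0
  -- The bound `δ / 2` is used because the initial simplices lie in the unit ball and have diameter
  -- at most 2.
  obtain ⟨r, hr⟩ := exists_pow_lt_of_lt_one (half_pos hδ)
    (show (m : ℝ) / (m + 1) < 1 by rw [div_lt_one (by positivity)]; linarith)
  let 𝒞 : Set (Set (Fin (m + 1) → ℝ)) :=
    {C | ∃ ε : ℕ → ℝ, (∀ i, |ε i| = 1) ∧ C = orthantSlab m ε}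
  have h𝒞 : ∀ C ∈ 𝒞, Convex ℝ C := by
    rintro _ ⟨ε, -, rfl⟩
    exact convex_orthantSlab m ε
  have h𝒞K : ∀ C ∈ 𝒞, C ⊆ crossRegion m := by
    rintro _ ⟨ε, hε, rfl⟩
    exact orthantSlab_subset hε
  let z : ℕ → Chain (Fin (m + 1) → ℝ) :=
    fun k => (subdivide (k + 1))^[r] (hemisphere (crossVertex m) k)
  have hz : ∀ k ≤ m, z k ∈ chainsOf (IsSmallSimplex 𝒞 (k + 1) ((m / (m + 1)) ^ r * 2)) := by
    intro k hk
    refine iterate_subdivide_mem h𝒞 (by omega) (by norm_num) r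
      (chainsOf_mono ?_ (hemisphere_mem _ k))
    rintro l ⟨hl, ε, hε, h⟩
    have hmem : ∀ v ∈ l, v ∈ orthantSlab m ε := fun v hv => by
      obtain ⟨i, hi, rfl⟩ := h v hv
      exact smul_crossVertex_mem (hi.trans hk) hε
    refine ⟨hl, ⟨_, ⟨ε, hε, rfl⟩, hmem⟩, fun v hv w hw => ?_⟩
    have h1 := (hmem v hv).1
    have h2 := (hmem w hw).1
    rw [dist_eq_norm]
    linarith [norm_sub_le v w]
  let s : ℕ → (Fin (m + 1) → ℝ) → ZMod 2 :=
    fun i v => if h : i < m then oddSign (f v ⟨i, h⟩) v else 0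
  have hs : ∀ i < m, ∀ v, v ≠ 0 → s i (-v) = s i v + 1 := by
    intro i hi v hv
    simp only [s, hi, dif_pos, hodd v hv, Pi.neg_apply]
    exact oddSign_neg _ hv
  have hone := evalCochain_coboundaryProduct_eq_one (s := s) (g := Neg.neg) (p := fun v => v ≠ 0)
    (z := z) (v₀ := crossVertex m 0) hs
    (Function.iterate_fixed (subdivide_vertex _) r)
    (fun k _ => by
      have h1 : Function.Semiconj boundary (subdivide (k + 2)) (subdivide (k + 1)) :=
        boundary_subdivide (E := Fin (m + 1) → ℝ) (k + 1)
      have h2 : Function.Semiconj (pushforward (Neg.neg : (Fin (m + 1) → ℝ) → _)) (subdivide (k + 1)) (subdivide (k + 1)) :=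
        pushforward_subdivide (E := Fin (m + 1) → ℝ) (k + 1)
      simp only [z]
      rw [h1.iterate_right r, boundary_hemisphere, iterate_map_add, h2.iterate_right r])
    (fun k hk => chainsOf_mono (fun l ⟨_, ⟨C, hC, h⟩, _⟩ v hv =>
      ne_zero_of_mem_crossRegion (h𝒞K C hC (h v hv))) (hz k hk.le)) le_rfl
  have hzero : evalCochain (coboundaryProduct s m) (z m) = 0 := by
    refine (Submodule.mem_bot (ZMod 2)).1 (map_mem_of_chainsOf _ ⊥ (fun l hl => ?_) (hz m le_rfl))
    obtain ⟨hlen, ⟨C, hC, hlC⟩, hd⟩ := hl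
    obtain ⟨v, hv⟩ := List.exists_mem_of_length_pos (by omega : 0 < l.length)
    have hvK := h𝒞K C hC (hlC v hv)
    -- The norm is the supremum norm, so some coordinate attains at least the minimum `a`.
    obtain ⟨i, hi⟩ : ∃ i, a ≤ |f v i| := by
      by_contra! hlt
      exact ((pi_norm_lt_iff ha0).2 hlt).not_ge (hmin hvK)
    rw [evalCochain_single, Submodule.mem_bot]
    refine coboundaryProduct_eq_zero s i.2 (a := s i v) fun w hw => ?_
    have hdist := hunif w (h𝒞K C hC (hlC w hw)) v hvK
      ((hd w hw v hv).trans_lt (by linarith))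
    have h1 := (dist_le_pi_dist (f w) (f v) i).trans_lt hdist
    rw [Real.dist_eq, abs_lt] at h1
    simp only [s, i.2, dif_pos, Fin.eta, oddSign]
    -- The `i`-th coordinate is nonzero with constant sign on the simplex, so the tie-breaking rule
    -- of `oddSign` plays no part.
    rcases le_abs.1 hi with h2 | h2
    · rw [if_pos (Or.inl (by linarith)), if_pos (Or.inl (by linarith))]
    · rw [if_neg, if_neg]
      · rintro (h | h) <;> linarith [h]
      · rintro (h | h) <;> linarith [h]
  rw [hzero] at hone
  exact zero_ne_one hone

end BorsukUlam

/-! ### Rescaling an eigenvector on its nodal domains. -/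

section NodalDomains

variable {κ : Type*}

/-- The nodal domains of `x`. -/
abbrev NodalDomain (G : SimpleGraph κ) (x : κ → ℝ) :=
  (G.induce {j | x j ≠ 0}).ConnectedComponent

open Classical in
/-- The vector obtained from `x` by multiplying it with `t C` on each nodal domain `C`. -/
def nodalScale (G : SimpleGraph κ) (x : κ → ℝ) (t : NodalDomain G x → ℝ) (j : κ) : ℝ :=
  if h : x j ≠ 0 then t ((G.induce {j | x j ≠ 0}).connectedComponentMk ⟨j, h⟩) * x j else 0

lemma continuous_nodalScale (G : SimpleGraph κ) (x : κ → ℝ) :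
    Continuous (nodalScale G x) := by
  refine continuous_pi fun j => ?_
  by_cases h : x j = 0
  · simp only [nodalScale, h, ne_eq, not_true_eq_false, dif_neg, not_false_eq_true]
    exact continuous_const
  · simp only [nodalScale, ne_eq, h, not_false_eq_true, dif_pos]
    fun_prop

lemma nodalScale_smul (G : SimpleGraph κ) (x : κ → ℝ) (c : ℝ) (t : NodalDomain G x → ℝ) :
    nodalScale G x (c • t) = c • nodalScale G x t := by
  ext j
  by_cases h : x j = 0 <;> simp [nodalScale, h, mul_assoc]

lemma nodalScale_neg (G : SimpleGraph κ) (x : κ → ℝ) (t : NodalDomain G x → ℝ) :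
    nodalScale G x (-t) = -nodalScale G x t := by
  rw [← neg_one_smul ℝ t, nodalScale_smul, neg_one_smul]

lemma nodalScale_ne_zero (G : SimpleGraph κ) (x : κ → ℝ) {t : NodalDomain G x → ℝ} (ht : t ≠ 0) :
    nodalScale G x t ≠ 0 := by
  obtain ⟨C, hC⟩ := Function.ne_iff.1 ht
  induction C using SimpleGraph.ConnectedComponent.ind with
  | _ j =>
    refine Function.ne_iff.2 ⟨j.1, ?_⟩
    have hj : x j.1 ≠ 0 := j.2
    simp only [nodalScale, hj, ne_eq, not_false_eq_true, dif_pos]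
    exact mul_ne_zero hC hj

lemma mul_eq_abs_of_mem_Sgn {a z : ℝ} (h : z ∈ Sgn a) : a * z = |a| := by
  unfold Sgn at h
  split_ifs at h with h1 h2
  · rw [Set.mem_singleton_iff.1 h, abs_of_pos h1, mul_one]
  · rw [Set.mem_singleton_iff.1 h, abs_of_neg h2]; ring
  · obtain rfl : a = 0 := by linarith
    simp

variable {ι : Type*} [Fintype ι] [Fintype κ]

/-- On the span of the restrictions of an eigenvector to its nodal domains, the energy is the
eigenvalue times the norm. -/
lemma energy_nodalScale {B : Matrix ι κ ℝ} {d : κ → ℕ} {G : SimpleGraph κ}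
    (hG : ∀ i j j', j ≠ j' → B i j ≠ 0 → B i j' ≠ 0 → G.Adj j j') {μ : ℝ} {x : κ → ℝ}
    (hx : IsEigenpair B d μ x) (t : NodalDomain G x → ℝ) :
    energy B (nodalScale G x t) = μ * weightedNorm d (nodalScale G x t) := by
  obtain ⟨-, u, ⟨w, hw, rfl⟩, z, hz, hzu⟩ := hx
  let τ : κ → ℝ := fun j => by
    classical
    exact if h : x j ≠ 0 then t ((G.induce {j | x j ≠ 0}).connectedComponentMk ⟨j, h⟩) else 0
  have hτ : ∀ j, nodalScale G x t j = τ j * x j := fun j => by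
    by_cases h : x j = 0 <;> simp [nodalScale, τ, h]
  have hconst : ∀ i j j', B i j * x j ≠ 0 → B i j' * x j' ≠ 0 → τ j = τ j' := by
    intro i j j' h h'
    rcases eq_or_ne j j' with rfl | hne
    · rfl
    have hj := right_ne_zero_of_mul h
    have hj' := right_ne_zero_of_mul h'
    simp only [τ, hj, hj', ne_eq, not_false_eq_true, dif_pos]
    congr 1
    refine SimpleGraph.ConnectedComponent.sound (SimpleGraph.Adj.reachable ?_)
    exact hG i j j' hne (left_ne_zero_of_mul h) (left_ne_zero_of_mul h')
  -- Row `i` of `Bx` is multiplied by one constant `c`, and `z i` turns `(Bx)_i` into its absolute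
  -- value.
  have hrow : ∀ i, |(B *ᵥ nodalScale G x t) i| = ∑ j, |τ j| * (B i j * x j * z i) := by
    intro i
    have e : ∀ σ : κ → ℝ, ∀ c, (∀ j, B i j * x j ≠ 0 → σ j = c) →
        ∑ j, σ j * (B i j * x j) = c * (B *ᵥ x) i := by
      intro σ c h
      rw [Matrix.mulVec, dotProduct, Finset.mul_sum]
      refine Finset.sum_congr rfl fun j _ => ?_
      rcases eq_or_ne (B i j * x j) 0 with h0 | h0
      · rw [h0, mul_zero, mul_zero]
      · rw [h j h0]
    obtain ⟨c, hc⟩ : ∃ c, ∀ j, B i j * x j ≠ 0 → τ j = c := by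
      by_cases h : ∃ j, B i j * x j ≠ 0
      · obtain ⟨j, hj⟩ := h
        exact ⟨τ j, fun j' hj' => hconst i j' j hj' hj⟩
      -- The row misses the support of `x`, so any constant would do.
      · exact ⟨0, fun j hj => absurd ⟨j, hj⟩ h⟩
    have h1 : (B *ᵥ nodalScale G x t) i = c * (B *ᵥ x) i := by
      rw [← e τ c hc, Matrix.mulVec, dotProduct]
      exact Finset.sum_congr rfl fun j _ => by rw [hτ]; ring
    have h2 : ∑ j, |τ j| * (B i j * x j * z i) = |c| * (B *ᵥ x) i * z i := by
      rw [← e (fun j => |τ j|) |c| fun j hj => by rw [hc j hj], Finset.sum_mul]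
      exact Finset.sum_congr rfl fun j _ => by ring
    rw [h1, h2, abs_mul, mul_assoc, mul_eq_abs_of_mem_Sgn (hz i)]
  simp only [energy, hrow]
  rw [Finset.sum_comm, weightedNorm, Finset.mul_sum]
  refine Finset.sum_congr rfl fun j _ => ?_
  have hj : ∑ i, B i j * z i = μ * (d j * w j) := congrFun hzu j
  calc ∑ i, |τ j| * (B i j * x j * z i) = |τ j| * x j * ∑ i, B i j * z i := by
        rw [Finset.mul_sum]
        exact Finset.sum_congr rfl fun i _ => by ring
    _ = |τ j| * μ * d j * (x j * w j) := by rw [hj]; ring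
    _ = μ * (d j * |nodalScale G x t j|) := by
        rw [mul_eq_abs_of_mem_Sgn (hw j), hτ, abs_mul]; ring

lemma weightedNorm_smul (d : κ → ℕ) (c : ℝ) (x : κ → ℝ) :
    weightedNorm d (c • x) = |c| * weightedNorm d x := by
  rw [weightedNorm, weightedNorm, Finset.mul_sum]
  exact Finset.sum_congr rfl fun j _ => by rw [Pi.smul_apply, smul_eq_mul, abs_mul]; ring

lemma weightedNorm_neg (d : κ → ℕ) (x : κ → ℝ) : weightedNorm d (-x) = weightedNorm d x := by
  simp [weightedNorm]

lemma weightedNorm_pos {d : κ → ℕ} (hd : ∀ j, 0 < d j) {x : κ → ℝ} (hx : x ≠ 0) :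
    0 < weightedNorm d x := by
  obtain ⟨j, hj⟩ := Function.ne_iff.1 hx
  refine Finset.sum_pos' (fun _ _ => by positivity) ⟨j, Finset.mem_univ _, ?_⟩
  have := hd j
  have := abs_pos.2 hj
  positivity

lemma continuous_weightedNorm (d : κ → ℕ) : Continuous (weightedNorm d) := by
  unfold weightedNorm
  fun_prop

/-! ### Genus of the sphere of rescaled eigenvectors. -/

/-- The unit sphere of the span of the restrictions of `x` to its nodal domains. -/
def nodalSphere (d : κ → ℕ) (G : SimpleGraph κ) (x : κ → ℝ) : Set (κ → ℝ) :=
  {y | weightedNorm d y = 1 ∧ ∃ t, y = nodalScale G x t}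

lemma inv_smul_mem_nodalSphere {d : κ → ℕ} (hd : ∀ j, 0 < d j) (G : SimpleGraph κ) (x : κ → ℝ)
    {t : NodalDomain G x → ℝ} (ht : t ≠ 0) :
    (weightedNorm d (nodalScale G x t))⁻¹ • nodalScale G x t ∈ nodalSphere d G x := by
  have h := weightedNorm_pos hd (nodalScale_ne_zero G x ht)
  refine ⟨?_, _, (nodalScale_smul G x _ t).symm⟩
  rw [weightedNorm_smul, abs_of_pos (inv_pos.2 h), inv_mul_cancel₀ h.ne']

/-- An odd map from the nodal sphere to the unit sphere of `ℝᵐ`, with `m` less than the number of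
domains, would compose with an odd map from `ℝᵐ⁺¹ ∖ {0}` to the nodal sphere and contradict
`borsuk_ulam`. Scaling factors on `m + 1` of the domains suffice; the others get 0. -/
lemma nodalCount_le_genus {d : κ → ℕ} (hd : ∀ j, 0 < d j) (G : SimpleGraph κ) (x : κ → ℝ) :
    (nodalCount G x : ℕ∞) ≤ genus (nodalSphere d G x) := by
  refine le_iInf₂ fun m ⟨h, hcont, hmaps, hodd⟩ => ?_
  by_contra! hlt
  have hlt' : m < nodalCount G x := by exact_mod_cast hlt
  classical
  have : Finite (NodalDomain G x) := Quot.finite _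
  have := Fintype.ofFinite (NodalDomain G x)
  obtain ⟨e⟩ : Nonempty (Fin (m + 1) ↪ NodalDomain G x) := by
    refine Function.Embedding.nonempty_of_card_le ?_
    rw [Fintype.card_fin, ← Nat.card_eq_fintype_card]
    exact hlt'
  let T : (Fin (m + 1) → ℝ) → NodalDomain G x → ℝ := fun v C =>
    ∑ i, if e i = C then v i else 0
  have hTe : ∀ v i, T v (e i) = v i := fun v i => by simp [T]
  have hTcont : Continuous T := by
    refine continuous_pi fun C => continuous_finsetSum _ fun i _ => ?_
    split_ifs <;> fun_prop
  have hTneg : ∀ v, T (-v) = -T v := fun v => by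
    ext C
    simp only [T, Pi.neg_apply, ← Finset.sum_neg_distrib]
    exact Finset.sum_congr rfl fun i _ => by split_ifs <;> simp
  have hT0 : ∀ v ≠ 0, T v ≠ 0 := fun v hv hTv => hv (funext fun i => by
    rw [← hTe v i, hTv]; rfl)
  let Y : (Fin (m + 1) → ℝ) → κ → ℝ := fun v => nodalScale G x (T v)
  let N : (Fin (m + 1) → ℝ) → κ → ℝ := fun v => (weightedNorm d (Y v))⁻¹ • Y v
  have hY : Continuous Y := (continuous_nodalScale G x).comp hTcont
  have hN : ∀ v ≠ 0, N v ∈ nodalSphere d G x := fun v hv =>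
    inv_smul_mem_nodalSphere hd G x (hT0 v hv)
  have hNneg : ∀ v, N (-v) = -N v := fun v => by
    simp only [N, Y, hTneg, nodalScale_neg, weightedNorm_neg, smul_neg]
  have hNcont : ContinuousOn N {0}ᶜ :=
    (((continuous_weightedNorm d).comp hY).continuousOn.inv₀ fun v hv =>
      (weightedNorm_pos hd (nodalScale_ne_zero G x (hT0 v hv))).ne').smul hY.continuousOn
  obtain ⟨v, hv, hfv⟩ := borsuk_ulam (f := fun v => (h (N v)).ofLp)
    ((PiLp.continuous_ofLp 2 _).comp_continuousOn (hcont.comp hNcont hN))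
    (fun v hv => by simp only [hNneg, hodd _ (hN v hv), WithLp.ofLp_neg])
  have h1 : ‖h (N v)‖ = 1 := by simpa using hmaps (hN v hv)
  rw [(WithLp.ofLp_eq_zero 2).1 hfv, norm_zero] at h1
  exact zero_ne_one h1

/-! ### Comparison of variational eigenvalues. -/

/-- The suprema of the energy over the admissible sets of genus at least `k`. -/
def admissibleSuprema (B : Matrix ι κ ℝ) (d : κ → ℕ) (k : ℕ) : Set ℝ :=
  {a | ∃ T : Set (κ → ℝ), (∀ x ∈ T, weightedNorm d x = 1) ∧ (∀ x ∈ T, -x ∈ T) ∧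
    (k : ℕ∞) ≤ genus T ∧ IsLUB (energy B '' T) a}

lemma bddBelow_admissibleSuprema (B : Matrix ι κ ℝ) (d : κ → ℕ) (k : ℕ) :
    BddBelow (admissibleSuprema B d k) := by
  refine ⟨0, ?_⟩
  rintro a ⟨T, -, -, -, ha⟩
  -- The empty set contributes nothing even for `k = 0`: a least upper bound of it would be a least
  -- real number.
  rcases T.eq_empty_or_nonempty with rfl | ⟨x, hx⟩
  · rw [Set.image_empty, isLUB_empty_iff] at ha
    exact absurd ha (not_isBot a)
  · exact (Finset.sum_nonneg fun _ _ => abs_nonneg _).trans (ha.1 ⟨x, hx, rfl⟩)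

/-- A larger genus bound leaves fewer competitors. Nonemptiness matters because the real infimum of
the empty set is 0. -/
lemma variationalEigenvalue_mono {B : Matrix ι κ ℝ} {d : κ → ℕ} {j k : ℕ} (hjk : j ≤ k)
    (hk : (admissibleSuprema B d k).Nonempty) :
    variationalEigenvalue B d j ≤ variationalEigenvalue B d k :=
  csInf_le_csInf (bddBelow_admissibleSuprema B d j) hk fun _ ⟨T, h1, h2, h3, h4⟩ =>
    ⟨T, h1, h2, le_trans (by exact_mod_cast hjk) h3, h4⟩

lemma nodalCount_pos (G : SimpleGraph κ) {x : κ → ℝ} (hx : x ≠ 0) : 1 ≤ nodalCount G x := by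
  obtain ⟨j, hj⟩ := Function.ne_iff.1 hx
  have : Finite (NodalDomain G x) := Quot.finite _
  have : Nonempty (NodalDomain G x) :=
    ⟨(G.induce {j | x j ≠ 0}).connectedComponentMk ⟨j, hj⟩⟩
  exact Nat.card_pos

lemma nodalCount_le_card (G : SimpleGraph κ) (x : κ → ℝ) :
    nodalCount G x ≤ Fintype.card κ := by
  rw [← Nat.card_eq_fintype_card]
  exact (Nat.card_le_card_of_surjective (G.induce {j | x j ≠ 0}).connectedComponentMk
    Quot.mk_surjective).trans (Finite.card_subtype_le _)

/-- The eigenvalue of `x` belongs to the admissible suprema for the number of its nodal domains. -/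
lemma eigenvalue_mem_admissibleSuprema {B : Matrix ι κ ℝ} {d : κ → ℕ} (hd : ∀ j, 0 < d j)
    {G : SimpleGraph κ} (hG : ∀ i j j', j ≠ j' → B i j ≠ 0 → B i j' ≠ 0 → G.Adj j j')
    {μ : ℝ} {x : κ → ℝ} (hx : IsEigenpair B d μ x) :
    μ ∈ admissibleSuprema B d (nodalCount G x) := by
  refine ⟨nodalSphere d G x, fun y hy => hy.1, ?_, nodalCount_le_genus hd G x, ?_⟩
  · rintro _ ⟨h, t, rfl⟩
    exact ⟨by rw [weightedNorm_neg, h], -t, (nodalScale_neg G x t).symm⟩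
  · have himage : energy B '' nodalSphere d G x = {μ} := by
      refine Set.eq_singleton_iff_nonempty_unique_mem.2 ⟨Set.Nonempty.image _ ?_, ?_⟩
      · obtain ⟨j, hj⟩ := Function.ne_iff.1 hx.1
        exact ⟨_, inv_smul_mem_nodalSphere hd G x (t := fun _ => 1) fun h =>
          one_ne_zero (congrFun h ((G.induce {j | x j ≠ 0}).connectedComponentMk ⟨j, hj⟩))⟩
      · rintro _ ⟨_, ⟨h, t, rfl⟩, rfl⟩
        rw [energy_nodalScale hG hx, h, mul_one]
    rw [himage]
    exact isLUB_singleton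

/-- The Courant nodal domain theorem for the 1-Laplacian of a matrix whose rows are supported on
cliques of `G`. -/
theorem courant_nodal_domain {B : Matrix ι κ ℝ} {d : κ → ℕ} (hd : ∀ j, 0 < d j)
    {G : SimpleGraph κ} (hG : ∀ i j j', j ≠ j' → B i j ≠ 0 → B i j' ≠ 0 → G.Adj j j')
    {k : ℕ} (hk : 1 ≤ k) (hkn : k ≤ Fintype.card κ) {x : κ → ℝ}
    (hx : IsEigenpair B d (variationalEigenvalue B d k) x) :
    1 ≤ nodalCount G x ∧ nodalCount G x ≤ k + eigenvalueMultiplicity B d k - 1 := by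
  refine ⟨nodalCount_pos G hx.1, ?_⟩
  have hmem := eigenvalue_mem_admissibleSuprema hd hG hx
  -- The maximum keeps `k` itself in the interval when there are fewer than `k` domains, so the
  -- multiplicity is at least 1 in every case.
  have hsub : (Finset.Icc k (max k (nodalCount G x)) : Set ℕ) ⊆
      {j : ℕ | 1 ≤ j ∧ j ≤ Fintype.card κ ∧
        variationalEigenvalue B d j = variationalEigenvalue B d k} := by
    intro j hj
    obtain ⟨hkj, hjS⟩ := Finset.mem_Icc.1 hj
    refine ⟨hk.trans hkj, hjS.trans (max_le hkn (nodalCount_le_card G x)), ?_⟩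
    rcases hkj.eq_or_lt with rfl | hlt
    · rfl
    have hj' : j ≤ nodalCount G x := (le_max_iff.1 hjS).resolve_left hlt.not_ge
    have hmem' : variationalEigenvalue B d k ∈ admissibleSuprema B d j := by
      obtain ⟨T, h1, h2, h3, h4⟩ := hmem
      exact ⟨T, h1, h2, le_trans (by exact_mod_cast hj') h3, h4⟩
    -- The nodal sphere competes for `c_j`, giving `c_j ≤ c_k`; monotonicity gives the converse.
    exact le_antisymm (csInf_le (bddBelow_admissibleSuprema B d j) hmem')
      (variationalEigenvalue_mono hkj ⟨_, hmem'⟩)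
  have hfin : {j : ℕ | 1 ≤ j ∧ j ≤ Fintype.card κ ∧
      variationalEigenvalue B d j = variationalEigenvalue B d k}.Finite :=
    (Set.finite_Iic (Fintype.card κ)).subset fun j hj => hj.2.1
  have hcard := Set.ncard_le_ncard hsub hfin
  rw [Set.ncard_coe_finset, Nat.card_Icc] at hcard
  change _ ≤ eigenvalueMultiplicity B d k at hcard
  omega

end NodalDomains

/-! ### Rows of the incidence matrices as cliques of the neighbour graphs. -/

lemma upGraph_adj_of_upIncidence {V : Type*} (K : SComplex V) (n : ℕ) (G : Face K (n + 1))
    (F F' : Face K n) (hne : F ≠ F') (h : upIncidence K n G F ≠ 0)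
    (h' : upIncidence K n G F' ≠ 0) : (upGraph K n).Adj F F' :=
  ⟨hne, G, by simpa [upIncidence] using h, by simpa [upIncidence] using h'⟩

lemma downGraph_adj_of_downIncidence {V : Type*} (K : SComplex V) (n : ℕ) (E : FaceOfCard K n)
    (F F' : Face K n) (hne : F ≠ F') (h : downIncidence K n E F ≠ 0)
    (h' : downIncidence K n E F' ≠ 0) : (downGraph K n).Adj F F' :=
  ⟨hne, E, by simpa [downIncidence] using h, by simpa [downIncidence] using h'⟩

end SignlessLaplacian

end

open SignlessLaplacian
theorem mainTheorem1 {V : Type*} [Finite V] (K : SComplex V) (n : ℕ) :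
    ((∀ F : Face K n, 0 < upDegree K n F) →
      ∀ k : ℕ, 1 ≤ k → k ≤ Fintype.card (Face K n) → ∀ x : Face K n → ℝ,
        IsEigenpair (upIncidence K n) (upDegree K n)
          (variationalEigenvalue (upIncidence K n) (upDegree K n) k) x →
        1 ≤ nodalCount (upGraph K n) x ∧
        nodalCount (upGraph K n) x ≤
          k + eigenvalueMultiplicity (upIncidence K n) (upDegree K n) k - 1) ∧
    (∀ k : ℕ, 1 ≤ k → k ≤ Fintype.card (Face K n) → ∀ x : Face K n → ℝ,
        IsEigenpair (downIncidence K n) (downDegree K n)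
          (variationalEigenvalue (downIncidence K n) (downDegree K n) k) x →
        1 ≤ nodalCount (downGraph K n) x ∧
        nodalCount (downGraph K n) x ≤
          k + eigenvalueMultiplicity (downIncidence K n) (downDegree K n) k - 1) :=
  ⟨fun hd _ hk hkn _ hx =>
      courant_nodal_domain hd (upGraph_adj_of_upIncidence K n) hk hkn hx,
    fun _ hk hkn _ hx =>
      courant_nodal_domain (fun F => by rw [downDegree_eq]; exact n.succ_pos)
        (downGraph_adj_of_downIncidence K n) hk hkn hx⟩
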